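/- Let $K\ge 3$, let $\mathsf P$ be the family of non-empty subsets of $[1:K]=\{1,\dots,K\}$, and for each $S\in\mathsf P$ let $C_S\ge 0$ be a real number. In the $K$-user combination network the source $X$ is connected to an intermediate node $V_S$ by a noiseless link of capacity $C_S$ bits per channel use (for each $S\in\mathsf P$), and receiver $Y_i$ observes noiselessly all $V_S$ with $i\in S$, so that in $n$ channel uses the link to $V_S$ carries one of $\lfloor 2^{nC_S}\rfloor$ values. If all the numbers $2^{C_S}$ are integers, one may equivalently take the memoryless deterministic broadcast channel with input $X=(V_S)_{S\in\mathsf P}$, $V_S\in\mathcal V_S$, $|\mathcal V_S|=2^{C_S}$, and outputs $Y_i=(V_S)_{S\ni i}$; the statement below holds for both models. Write $S_l=\{K-1,K\}$ (the common receivers) and $S_p=[1:K]\setminus S_l$ (the private receivers). Two independent, uniformly distributed messages are sent: a private message of rate $R_p$, to be decoded by every receiver in $S_p$, and a common message of rate $R_c$, to be decoded by all $K$ receivers (message index set $\mathsf E=\{S_p,[1:K]\}$). In a code of block length $n$ a message of rate $R\ge0$ takes values in $[1:2^{nR}]$. A rate pair is achievable if there are codes, one for each block length $n$, for which the probability that not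 all receivers decode their intended messages correctly tends to $0$ as $n\to\infty$; the capacity region is the closure of the set of achievable pairs. For $i\in[1:K]$ let $\mathsf W_i=\{S\in\mathsf P: i\in S\}$ and $\downarrow_{\mathsf W_i}\{S_p\}=\{S\in\mathsf W_i: S\subseteq S_p\}$, and for $\mathsf W\subseteq\mathsf P$ let $C_{\mathsf W}=\sum_{S\in\mathsf W}C_S$. Then the capacity region is the set of all pairs $(R_p,R_c)$ of non-negative real numbers such that \begin{align*} R_c&\le C_{\mathsf W_i} && \text{for all } i\in S_l,\\ R_c+R_p&\le C_{\mathsf W_j} && \text{for all } j\in S_p,\\ 2R_c+R_p&\le C_{\downarrow_{\mathsf W_j}\{S_p\}}+C_{\mathsf W_{K-1}}+C_{\mathsf W_K} && \text{for all } j\in S_p. \end{align*} -/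

import Mathlib

open Filter Topology

namespace CombNet

noncomputable section

/-! Receivers are indexed by `Fin K`; a message index is a set of receivers. -/

/-- The family of all non-empty subsets of the set of receivers. -/
def P (K : ℕ) : Finset (Finset (Fin K)) :=
  Finset.univ.filter fun S => S.Nonempty

/-- The members of the family `F` that contain the receiver `i`. -/
def W {K : ℕ} (i : Fin K) (F : Finset (Finset (Fin K))) : Finset (Finset (Fin K)) :=
  F.filter fun S => i ∈ S

theorem W_subset {K : ℕ} {i : Fin K} {F : Finset (Finset (Fin K))} : W i F ⊆ F :=
  Finset.filter_subset _ _

/-- The smallest down-set of `P K` (ordered by inclusion) containing `Q`. -/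
def down {K : ℕ} (Q : Finset (Finset (Fin K))) : Finset (Finset (Fin K)) :=
  (P K).filter fun S => ∃ T ∈ Q, S ⊆ T

/-- The down-set of `Q₁` in `Q₂`, that is `↓_{Q₂} Q₁`. -/
def downIn {K : ℕ} (Q₂ Q₁ : Finset (Finset (Fin K))) : Finset (Finset (Fin K)) :=
  down Q₁ ∩ Q₂

/-- The modular set function `C_F = ∑_{S ∈ F} C_S`. -/
def cap {K : ℕ} (C : Finset (Fin K) → ℝ) (F : Finset (Finset (Fin K))) : ℝ :=
  ∑ S ∈ F, C S

/-- A finite-alphabet broadcast channel with `K` receivers: `law x y` is the probability that the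
receivers observe `y = (y_k)_k` when `x` is sent. -/
structure BroadcastChannel (K : ℕ) where
  In : Type
  Out : Fin K → Type
  [fintypeOut : ∀ k, Fintype (Out k)]
  law : In → (∀ k, Out k) → ℝ
  law_nonneg : ∀ x y, 0 ≤ law x y
  law_sum : ∀ x, ∑ y, law x y = 1

attribute [instance] BroadcastChannel.fintypeOut

/-- `n` uses of the broadcast channel, without memory: the input is a sequence `x^n`, receiver `k`
observes `y_k^n`, and the transition probability is `∏_t law (x_t) (y_{1,t}, …, y_{K,t})`. -/
def BroadcastChannel.power {K : ℕ} (ch : BroadcastChannel K) (n : ℕ) : BroadcastChannel K where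
  In := Fin n → ch.In
  Out k := Fin n → ch.Out k
  law x y := ∏ t, ch.law (x t) (fun k => y k t)
  law_nonneg x y := Finset.prod_nonneg fun t _ => ch.law_nonneg _ _
  law_sum x := by
    classical
    rw [← Equiv.sum_comp (Equiv.piComm fun (_ : Fin n) (k : Fin K) => ch.Out k)
      (fun y : (∀ k, Fin n → ch.Out k) => ∏ t, ch.law (x t) (fun k => y k t))]
    have h := Finset.prod_univ_sum (fun _ : Fin n => (Finset.univ : Finset (∀ k, ch.Out k)))
      (fun t y => ch.law (x t) y)
    rw [Fintype.piFinset_univ] at h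
    simp only [ch.law_sum, Finset.prod_const_one] at h
    exact h.symm

/-- A block code for the channel `ch` and the message set `E`, with `M S` possible values of the
message intended for the receivers in `S ∈ E`. The decoder of receiver `k` outputs an estimate of
the messages with index in `W k E`. -/
structure Code {K : ℕ} (ch : BroadcastChannel K) (E : Finset (Finset (Fin K))) (M : E → ℕ) where
  enc : (∀ S : E, Fin (M S)) → ch.In
  dec : ∀ k, ch.Out k → ∀ S : W k E, Fin (M ⟨S.1, W_subset S.2⟩)

open Classical in
/-- The probability, for independent and uniformly distributed messages, that not all receivers
decode all their intended messages correctly. -/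
def Code.errorProb {K : ℕ} {ch : BroadcastChannel K} {E : Finset (Finset (Fin K))} {M : E → ℕ}
    (c : Code ch E M) : ℝ :=
  (∑ m : (∀ S : E, Fin (M S)), ∑ y : (∀ k, ch.Out k),
      ch.law (c.enc m) y *
        (if ∀ k, c.dec k (y k) = (fun S : W k E => m ⟨S.1, W_subset S.2⟩) then 0 else 1)) /
    Fintype.card (∀ S : E, Fin (M S))

/-- Achievability of the rate tuple `R` over a network that is used in blocks, where `net n` is the
channel seen by a block code of length `n`. The message with index `S` takes values in a set with
`⌊2 ^ (n R_S)⌋` elements. -/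
def Achievable {K : ℕ} (net : ℕ → BroadcastChannel K) (E : Finset (Finset (Fin K)))
    (R : E → ℝ) : Prop :=
  (∀ S, 0 ≤ R S) ∧
    ∃ c : ∀ n : ℕ, Code (net n) E (fun S => ⌊(2 : ℝ) ^ ((n : ℝ) * R S)⌋₊),
      Tendsto (fun n => (c n).errorProb) atTop (𝓝 0)

/-- The capacity region: the closure of the set of achievable rate tuples. -/
def capacityRegion {K : ℕ} (net : ℕ → BroadcastChannel K) (E : Finset (Finset (Fin K))) :
    Set (E → ℝ) :=
  closure {R | Achievable net E R}

open Classical in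
/-- The noiseless channel whose input has one component `V_S` in an alphabet of size `v S` for
every non-empty set `S` of receivers, where receiver `k` observes exactly the components `V_S`
with `k ∈ S`. -/
def combChannel {K : ℕ} (v : Finset (Fin K) → ℕ) : BroadcastChannel K where
  In := ∀ S : P K, Fin (v S.1)
  Out k := ∀ S : W k (P K), Fin (v S.1)
  law x y := if y = (fun k (S : W k (P K)) => x ⟨S.1, W_subset S.2⟩) then 1 else 0
  law_nonneg x y := by split_ifs <;> norm_num
  law_sum x := by simp

/-- The combination network as a discrete memoryless broadcast channel: component alphabets of
sizes `v S`, used `n` times. -/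
def combDMBC {K : ℕ} (v : Finset (Fin K) → ℕ) (n : ℕ) : BroadcastChannel K :=
  (combChannel v).power n

/-- The combination network in which the source is connected to the intermediate node `V_S` by a
noiseless link of capacity `C S` bits per channel use: in `n` uses the link carries one of
`⌊2 ^ (n C_S)⌋` values, which is passed on unchanged to all receivers in `S`. -/
def combLinks {K : ℕ} (C : Finset (Fin K) → ℝ) (n : ℕ) : BroadcastChannel K :=
  combChannel fun S => ⌊(2 : ℝ) ^ ((n : ℝ) * C S)⌋₊

/-- The common receivers: the last two of the `K` receivers. -/
def commonRecv (K : ℕ) : Finset (Fin K) :=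
  Finset.univ.filter fun i => K ≤ i.1 + 2

/-- The private receivers: all the others. -/
def privRecv (K : ℕ) : Finset (Fin K) := (commonRecv K)ᶜ

/-- Two nested messages: a private one for `privRecv K` and a common one for all receivers. -/
def nested (K : ℕ) : Finset (Finset (Fin K)) := {privRecv K, Finset.univ}

/-- The rate of the private message. -/
def rateP {K : ℕ} (R : nested K → ℝ) : ℝ := R ⟨privRecv K, by simp [nested]⟩

/-- The rate of the common message. -/
def rateC {K : ℕ} (R : nested K → ℝ) : ℝ := R ⟨Finset.univ, by simp [nested]⟩

/-- The non-negative rate pairs that satisfy the three groups of inequalities. The last two sums on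
the right-hand side of the third group are taken together, as a sum over the two common
receivers. -/
def region {K : ℕ} (C : Finset (Fin K) → ℝ) : Set (nested K → ℝ) :=
  {R | 0 ≤ rateC R ∧ 0 ≤ rateP R ∧
    (∀ i ∈ commonRecv K, rateC R ≤ cap C (W i (P K))) ∧
    (∀ j ∈ privRecv K, rateC R + rateP R ≤ cap C (W j (P K))) ∧
    (∀ j ∈ privRecv K, 2 * rateC R + rateP R ≤
      cap C (downIn (W j (P K)) {privRecv K}) + ∑ i ∈ commonRecv K, cap C (W i (P K)))}

end

end CombNet

/-!
Converse. Let `p`, `q` be the common receivers and `j` a private one. Two random variables `f₁` and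
`f₂` that both determine `u` satisfy `2 H(u) + H(f₁, f₂ | u) ≤ H(f₁) + H(f₂)`; here `f₁`, `f₂` are
the observations of `p` and `q` and `u` is the common message. What `p`, `q` and `j` observe
together adds to `f₁`, `f₂` only the components reaching `j` but neither `p` nor `q`, and it
determines both messages. As the messages are uniform and the links noiseless, the entropies can be
replaced by cardinalities, with a Cauchy–Schwarz inequality in the place of the entropy inequality.

Achievability. The messages are split into parts, each part is labelled by a set `T` of receivers
that decode it, and it is spread by an independent uniform random codebook over the components `V_S`
with `S ⊆ T`. By a union bound over the parts that may be confused, this works as soon as, at every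
receiver, every set `Q` of labels carries a total rate below the capacity of the observed part of
the down-set of `Q`. It then suffices to split the private message into a part decoded by all, two
parts hidden from one of `p`, `q`, and one hidden from both, so that all these inequalities hold;
the one on `2 R_c + R_p` is what makes room for the last part.
-/

namespace CombNet

variable {K : ℕ} {E : Finset (Finset (Fin K))}

/-! ### Relabelling inputs and outputs -/

/-- A relabelling of the input and output alphabets that carries the law of `ch` to that of
`ch'`. -/
structure BroadcastChannel.Iso (ch ch' : BroadcastChannel K) where
  inEquiv : ch.In ≃ ch'.In
  outEquiv : ∀ k, ch.Out k ≃ ch'.Out k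
  law_map : ∀ x y, ch'.law (inEquiv x) (fun k => outEquiv k (y k)) = ch.law x y

/-- The inverse relabelling. -/
def BroadcastChannel.Iso.symm {ch ch' : BroadcastChannel K} (e : ch.Iso ch') : ch'.Iso ch where
  inEquiv := e.inEquiv.symm
  outEquiv k := (e.outEquiv k).symm
  law_map x y := by simp [← e.law_map]

/-- The code obtained by relabelling the inputs and outputs of the channel. -/
def Code.relabel {ch ch' : BroadcastChannel K} {M : E → ℕ} (c : Code ch E M) (e : ch.Iso ch') :
    Code ch' E M where
  enc m := e.inEquiv (c.enc m)
  dec k y := c.dec k ((e.outEquiv k).symm y)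

theorem Code.errorProb_relabel {ch ch' : BroadcastChannel K} {M : E → ℕ} (c : Code ch E M)
    (e : ch.Iso ch') : (c.relabel e).errorProb = c.errorProb := by
  unfold Code.errorProb
  congr 1
  refine Finset.sum_congr rfl fun m _ => ?_
  rw [← Equiv.sum_comp (Equiv.piCongrRight e.outEquiv)]
  refine Finset.sum_congr rfl fun y _ => ?_
  simp only [Code.relabel, Equiv.piCongrRight_apply, Pi.map_apply, Equiv.symm_apply_apply,
    ← e.law_map (c.enc m) y]
  rfl

theorem Achievable.relabel {net net' : ℕ → BroadcastChannel K} {R : E → ℝ}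
    (h : Achievable net E R) (e : ∀ n, (net n).Iso (net' n)) : Achievable net' E R := by
  obtain ⟨hR, c, hc⟩ := h
  exact ⟨hR, fun n => (c n).relabel (e n), by simpa only [Code.errorProb_relabel] using hc⟩

theorem capacityRegion_congr {net net' : ℕ → BroadcastChannel K} (e : ∀ n, (net n).Iso (net' n)) :
    capacityRegion net E = capacityRegion net' E := by
  have h : ∀ R, Achievable net E R ↔ Achievable net' E R := fun R =>
    ⟨fun h => h.relabel e, fun h => h.relabel fun n => (e n).symm⟩
  simp only [capacityRegion, h]

/-- What receiver `k` sees of the link values `x`. -/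
def observe {w : Finset (Fin K) → ℕ} (k : Fin K) (x : ∀ S : P K, Fin (w S)) :
    ∀ S : W k (P K), Fin (w S) :=
  fun S => x ⟨S, W_subset S.2⟩

theorem observe_eq_iff {w : Finset (Fin K) → ℕ} {k : Fin K} {x x' : ∀ S : P K, Fin (w S)} :
    observe k x = observe k x' ↔ ∀ S : P K, k ∈ S.1 → x S = x' S :=
  ⟨fun h S hS => congrFun h ⟨S, Finset.mem_filter.2 ⟨S.2, hS⟩⟩,
    fun h => funext fun S => h ⟨S, W_subset S.2⟩ (Finset.mem_filter.1 S.2).2⟩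

open Classical in
theorem combChannel_law {w : Finset (Fin K) → ℕ} (x : ∀ S : P K, Fin (w S))
    (y : ∀ k, ∀ S : W k (P K), Fin (w S)) :
    (combChannel w).law x y = if y = (fun k => observe k x) then 1 else 0 := rfl

/-- A block of `n` families of symbols, read as a family of blocks of `n` symbols. -/
def blockEquiv {ι : Type} (v : ι → ℕ) (n : ℕ) :
    (Fin n → ∀ i : ι, Fin (v i)) ≃ ∀ i : ι, Fin (v i ^ n) :=
  (Equiv.piComm fun (_ : Fin n) (i : ι) => Fin (v i)).trans
    (Equiv.piCongrRight fun _ => finFunctionFinEquiv)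

open Classical in
theorem combDMBC_law {v : Finset (Fin K) → ℕ} {n : ℕ} (x : Fin n → ∀ S : P K, Fin (v S))
    (y : ∀ k, Fin n → ∀ S : W k (P K), Fin (v S)) :
    (combDMBC v n).law x y = if ∀ k t, y k t = observe k (x t) then 1 else 0 := by
  have hpow : (combDMBC v n).law x y =
      ∏ t : Fin n, (combChannel v).law (x t) (fun k => y k t) := rfl
  rw [hpow, Finset.prod_congr rfl fun t _ => combChannel_law (x t) (fun k => y k t),
    Finset.prod_ite_zero]
  simp only [Finset.prod_const_one, Finset.mem_univ, true_imp_iff, funext_iff (f := fun k => y k _)]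
  exact if_congr forall_comm rfl rfl

theorem combChannel_law_blockEquiv {v : Finset (Fin K) → ℕ} {n : ℕ}
    (x : Fin n → ∀ S : P K, Fin (v S)) (y : ∀ k, Fin n → ∀ S : W k (P K), Fin (v S)) :
    (combChannel fun S => v S ^ n).law (blockEquiv (fun S : P K => v S) n x)
      (fun k => blockEquiv (fun S : W k (P K) => v S) n (y k)) = (combDMBC v n).law x y := by
  have hobs : ∀ k, observe k (w := fun S => v S ^ n) (blockEquiv (fun S : P K => v S) n x)
      = blockEquiv (fun S : W k (P K) => v S) n (fun t => observe k (x t)) := fun _ => rfl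
  rw [combDMBC_law]
  refine (combChannel_law _ _).trans (if_congr ?_ rfl rfl)
  rw [funext_iff]
  refine forall_congr' fun k => ?_
  rw [hobs, Equiv.apply_eq_iff_eq, funext_iff]

/-- `n` uses of the memoryless network with alphabets `v` amount to one use with alphabets
`v ^ n`. -/
def combDMBCIso (v : Finset (Fin K) → ℕ) (n : ℕ) :
    (combDMBC v n).Iso (combChannel fun S => v S ^ n) where
  inEquiv := blockEquiv (fun S : P K => v S) n
  outEquiv k := blockEquiv (fun S : W k (P K) => v S) n
  law_map := combChannel_law_blockEquiv

theorem capacityRegion_combDMBC (v : Finset (Fin K) → ℕ) (E : Finset (Finset (Fin K))) :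
    capacityRegion (combDMBC v) E = capacityRegion (fun n => combChannel fun S => v S ^ n) E :=
  capacityRegion_congr (combDMBCIso v)

/-! ### Codes for noiseless links -/

/-- All receivers decode the message tuple `m` correctly. -/
def Code.Correct {w : Finset (Fin K) → ℕ} {M : E → ℕ} (c : Code (combChannel w) E M)
    (m : ∀ S : E, Fin (M S)) : Prop :=
  ∀ k, c.dec k (observe k (c.enc m)) = fun S : W k E => m ⟨S, W_subset S.2⟩

theorem Code.Correct.eq_of_observe_eq {w : Finset (Fin K) → ℕ} {M : E → ℕ}
    {c : Code (combChannel w) E M} {m m' : ∀ S : E, Fin (M S)} (h : c.Correct m)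
    (h' : c.Correct m') {k : Fin K} (hk : observe k (c.enc m) = observe k (c.enc m')) {S : E}
    (hS : k ∈ S.1) : m S = m' S := by
  have hdec := (h k).symm.trans ((congrArg (c.dec k) hk).trans (h' k))
  exact congrFun hdec ⟨S, Finset.mem_filter.2 ⟨S.2, hS⟩⟩

open Classical in
theorem Code.errorProb_combChannel {w : Finset (Fin K) → ℕ} {M : E → ℕ}
    (c : Code (combChannel w) E M) :
    c.errorProb = (Finset.univ.filter fun m => ¬ c.Correct m).card
      / (Fintype.card (∀ S : E, Fin (M S)) : ℝ) := by
  unfold Code.errorProb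
  rw [Finset.card_filter, Nat.cast_sum]
  congr! 2 with m
  refine (Fintype.sum_eq_single (fun k => observe k (c.enc m)) fun y hy => ?_).trans ?_
  · exact mul_eq_zero_of_left (if_neg hy) _
  · refine (congrArg (· * _) (if_pos rfl)).trans ?_
    rw [one_mul, Nat.cast_ite, ite_not, Nat.cast_zero, Nat.cast_one]
    exact if_congr Iff.rfl rfl rfl

open Classical in
theorem exists_code_of_enc {w : Finset (Fin K) → ℕ} {M : E → ℕ} (hM : ∀ S, 0 < M S)
    (enc : (∀ S : E, Fin (M S)) → ∀ S : P K, Fin (w S)) :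
    ∃ c : Code (combChannel w) E M, c.errorProb ≤
      (Finset.univ.filter fun m => ∃ k m', observe k (enc m) = observe k (enc m') ∧
        ∃ S : E, k ∈ S.1 ∧ m' S ≠ m S).card / (Fintype.card (∀ S : E, Fin (M S)) : ℝ) := by
  refine ⟨⟨enc, fun k y S => if h : ∃ m', observe k (enc m') = y
    then h.choose ⟨S, W_subset S.2⟩ else ⟨0, hM _⟩⟩, ?_⟩
  rw [Code.errorProb_combChannel]
  gcongr with m
  intro hm
  unfold Code.Correct at hm
  push Not at hm
  obtain ⟨k, hk⟩ := hm
  have hex : ∃ m', observe k (enc m') = observe k (enc m) := ⟨m, rfl⟩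
  simp only [dif_pos hex] at hk
  obtain ⟨S, hS⟩ := Function.ne_iff.1 hk
  exact ⟨k, hex.choose, hex.choose_spec.symm, ⟨S, W_subset S.2⟩, (Finset.mem_filter.1 S.2).2, hS⟩

/-! ### Exponential growth rates -/

theorem le_two_mul_floor {x : ℝ} (hx : 1 ≤ x) : x ≤ 2 * (⌊x⌋₊ : ℝ) := by
  have hfloor : (1 : ℝ) ≤ ⌊x⌋₊ := by exact_mod_cast (Nat.one_le_floor_iff x).2 hx
  linarith [Nat.lt_floor_add_one x]

theorem one_le_two_rpow (n : ℕ) {r : ℝ} (hr : 0 ≤ r) : 1 ≤ (2 : ℝ) ^ ((n : ℝ) * r) :=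
  Real.one_le_rpow one_le_two (by positivity)

theorem floor_two_rpow_pos (n : ℕ) {r : ℝ} (hr : 0 ≤ r) : 0 < ⌊(2 : ℝ) ^ ((n : ℝ) * r)⌋₊ :=
  Nat.floor_pos.2 (one_le_two_rpow n hr)

theorem two_rpow_nat_mul (n : ℕ) (r : ℝ) : (2 : ℝ) ^ ((n : ℝ) * r) = ((2 : ℝ) ^ r) ^ n := by
  rw [mul_comm, Real.rpow_mul zero_le_two, Real.rpow_natCast]

theorem two_rpow_nat_mul_sum {ι : Type*} (n : ℕ) (s : Finset ι) (r : ι → ℝ) :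
    (2 : ℝ) ^ ((n : ℝ) * ∑ i ∈ s, r i) = ∏ i ∈ s, (2 : ℝ) ^ ((n : ℝ) * r i) := by
  rw [Finset.mul_sum, Real.rpow_sum_of_pos two_pos]

theorem two_rpow_sum_le_prod_floor {ι : Type*} (n : ℕ) (s : Finset ι) {r : ι → ℝ}
    (hr : ∀ i ∈ s, 0 ≤ r i) :
    (2 : ℝ) ^ ((n : ℝ) * ∑ i ∈ s, r i) ≤
      2 ^ s.card * ↑(∏ i ∈ s, ⌊(2 : ℝ) ^ ((n : ℝ) * r i)⌋₊) := by
  rw [two_rpow_nat_mul_sum, Nat.cast_prod, ← Finset.prod_const, ← Finset.prod_mul_distrib]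
  exact Finset.prod_le_prod (fun _ _ => by positivity) fun i hi =>
    le_two_mul_floor (one_le_two_rpow n (hr i hi))

theorem le_of_eventually_two_rpow_le {a b c : ℝ}
    (h : ∀ᶠ n : ℕ in atTop, (2 : ℝ) ^ ((n : ℝ) * a) ≤ c * 2 ^ ((n : ℝ) * b)) : a ≤ b := by
  by_contra! hab
  have ht : Tendsto (fun n : ℕ => (2 : ℝ) ^ ((n : ℝ) * (a - b))) atTop atTop := by
    simp only [two_rpow_nat_mul]
    exact tendsto_pow_atTop_atTop_of_one_lt (Real.one_lt_rpow one_lt_two (sub_pos.2 hab))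
  obtain ⟨n, hle, hlt⟩ := (h.and (ht.eventually_gt_atTop c)).exists
  have hsplit : (2 : ℝ) ^ ((n : ℝ) * a) = 2 ^ ((n : ℝ) * (a - b)) * 2 ^ ((n : ℝ) * b) := by
    rw [← Real.rpow_add two_pos]
    ring_nf
  rw [hsplit] at hle
  exact (le_of_mul_le_mul_right hle (by positivity)).not_gt hlt

/-- The number of joint values of the links in `F`. -/
def numVals (w : Finset (Fin K) → ℕ) (F : Finset (Finset (Fin K))) : ℕ := ∏ S ∈ F, w S

theorem card_pi_links (w : Finset (Fin K) → ℕ) (F : Finset (Finset (Fin K))) :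
    Fintype.card (∀ S : F, Fin (w S)) = numVals w F := by
  rw [Fintype.card_pi]
  simp only [Fintype.card_fin]
  exact Finset.prod_coe_sort F w

/-- In block length `n` the link to `V_S` carries one of `w n S` values, where `w n S` is
`2 ^ (n C_S)` up to a factor of two. This covers both models of the combination network. -/
structure LinkSizes (C : Finset (Fin K) → ℝ) (w : ℕ → Finset (Fin K) → ℕ) : Prop where
  le : ∀ n : ℕ, ∀ S ∈ P K, (w n S : ℝ) ≤ 2 ^ ((n : ℝ) * C S)
  ge : ∀ n : ℕ, ∀ S ∈ P K, (2 : ℝ) ^ ((n : ℝ) * C S) ≤ 2 * w n S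

namespace LinkSizes

variable {C : Finset (Fin K) → ℝ} {w : ℕ → Finset (Fin K) → ℕ}

theorem pos (h : LinkSizes C w) (n : ℕ) {S : Finset (Fin K)} (hS : S ∈ P K) : 0 < w n S := by
  have hpos : (0 : ℝ) < 2 * w n S := lt_of_lt_of_le (by positivity) (h.ge n S hS)
  exact_mod_cast pos_of_mul_pos_right hpos zero_le_two

theorem numVals_le (h : LinkSizes C w) {F : Finset (Finset (Fin K))} (hF : F ⊆ P K) (n : ℕ) :
    (numVals (w n) F : ℝ) ≤ 2 ^ ((n : ℝ) * cap C F) := by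
  rw [cap, two_rpow_nat_mul_sum, numVals, Nat.cast_prod]
  exact Finset.prod_le_prod (fun _ _ => Nat.cast_nonneg _) fun S hS => h.le n S (hF hS)

theorem le_numVals (h : LinkSizes C w) {F : Finset (Finset (Fin K))} (hF : F ⊆ P K) (n : ℕ) :
    (2 : ℝ) ^ ((n : ℝ) * cap C F) ≤ 2 ^ F.card * numVals (w n) F := by
  rw [cap, two_rpow_nat_mul_sum, numVals, Nat.cast_prod, ← Finset.prod_const,
    ← Finset.prod_mul_distrib]
  exact Finset.prod_le_prod (fun _ _ => by positivity) fun S hS => h.ge n S (hF hS)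

theorem of_floor (hC : ∀ S ∈ P K, 0 ≤ C S) :
    LinkSizes C fun n S => ⌊(2 : ℝ) ^ ((n : ℝ) * C S)⌋₊ :=
  ⟨fun _ _ _ => Nat.floor_le (by positivity),
    fun n S hS => le_two_mul_floor (one_le_two_rpow n (hC S hS))⟩

theorem of_pow {v : Finset (Fin K) → ℕ} (hv : ∀ S ∈ P K, (v S : ℝ) = (2 : ℝ) ^ C S) :
    LinkSizes C fun n S => v S ^ n := by
  have hpow : ∀ n : ℕ, ∀ S ∈ P K, ((v S ^ n : ℕ) : ℝ) = 2 ^ ((n : ℝ) * C S) := fun n S hS => by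
    rw [Nat.cast_pow, hv S hS, two_rpow_nat_mul]
  exact ⟨fun n S hS => (hpow n S hS).le, fun n S hS => by
    rw [hpow n S hS]
    linarith [Real.rpow_pos_of_pos two_pos ((n : ℝ) * C S)]⟩

end LinkSizes

/-! ### Converse -/

section Counting

variable {Ω A D F₁ F₂ : Type*} [DecidableEq A] [Fintype D] [Fintype F₁] [Fintype F₂]
  {G : Finset Ω} {u : Ω → A}

theorem sum_card_image_fiber_le [DecidableEq F₁] {f : Ω → F₁}
    (hf : ∀ m ∈ G, ∀ m' ∈ G, f m = f m' → u m = u m') :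
    ∑ a ∈ G.image u, ((G.filter fun m => u m = a).image f).card ≤ Fintype.card F₁ := by
  rw [← Finset.card_biUnion]
  · exact Finset.card_le_univ _
  · intro a _ a' _ haa'
    rw [Function.onFun, Finset.disjoint_left]
    intro y hy hy'
    obtain ⟨m, hm, rfl⟩ := Finset.mem_image.1 hy
    obtain ⟨m', hm', h⟩ := Finset.mem_image.1 hy'
    rw [Finset.mem_filter] at hm hm'
    exact haa' (hm.2.symm.trans ((hf _ hm.1 _ hm'.1 h.symm).trans hm'.2))

/-- The counting form of `2 H(u) + H(f₁, f₂ | u) ≤ H(f₁) + H(f₂)`: on the fibre `G_a` of `u`, both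
`|G_a| ≤ B` and `|G_a| ≤ |D| |f₁(G_a)| |f₂(G_a)|` hold, and the Cauchy–Schwarz inequality sums the
geometric means of the two bounds. -/
theorem sq_card_le_of_determines {B : ℕ} (hB : ∀ a, (G.filter fun m => u m = a).card ≤ B)
    {f₁ : Ω → F₁} {f₂ : Ω → F₂} {g : Ω → D}
    (h₁ : ∀ m ∈ G, ∀ m' ∈ G, f₁ m = f₁ m' → u m = u m')
    (h₂ : ∀ m ∈ G, ∀ m' ∈ G, f₂ m = f₂ m' → u m = u m')
    (hg : ∀ m ∈ G, ∀ m' ∈ G, f₁ m = f₁ m' → f₂ m = f₂ m' → g m = g m' → m = m') :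
    G.card ^ 2 ≤ B * Fintype.card D * Fintype.card F₁ * Fintype.card F₂ := by
  classical
  set fiber : A → Finset Ω := fun a => G.filter fun m => u m = a
  have hsum : G.card = ∑ a ∈ G.image u, (fiber a).card :=
    Finset.card_eq_sum_card_fiberwise fun m hm => Finset.mem_image_of_mem u hm
  have hprod : ∀ a, (fiber a).card ≤
      Fintype.card D * ((fiber a).image f₁).card * ((fiber a).image f₂).card := fun a => by
    rw [← Finset.card_univ, ← Finset.card_product, ← Finset.card_product]
    refine Finset.card_le_card_of_injOn (fun m => ((g m, f₁ m), f₂ m)) (fun m hm => ?_)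
      fun m hm m' hm' h => ?_
    · exact Finset.mk_mem_product (Finset.mk_mem_product (Finset.mem_univ _)
        (Finset.mem_image_of_mem _ hm)) (Finset.mem_image_of_mem _ hm)
    · simp only [Prod.mk.injEq] at h
      exact hg m (Finset.mem_filter.1 hm).1 m' (Finset.mem_filter.1 hm').1 h.1.2 h.2 h.1.1
  calc G.card ^ 2 = (∑ a ∈ G.image u, (fiber a).card) ^ 2 := by rw [hsum]
    _ ≤ (∑ a ∈ G.image u, B * Fintype.card D * ((fiber a).image f₁).card) *
        ∑ a ∈ G.image u, ((fiber a).image f₂).card := by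
      refine Finset.sum_sq_le_sum_mul_sum_of_sq_le_mul _ (fun _ _ => Nat.zero_le _)
        (fun _ _ => Nat.zero_le _) fun a _ => ?_
      calc (fiber a).card ^ 2 = (fiber a).card * (fiber a).card := sq _
        _ ≤ B * (Fintype.card D * ((fiber a).image f₁).card * ((fiber a).image f₂).card) :=
          Nat.mul_le_mul (hB a) (hprod a)
        _ = _ := by ring
    _ ≤ B * Fintype.card D * Fintype.card F₁ * Fintype.card F₂ := by
      rw [← Finset.mul_sum]
      gcongr
      · exact sum_card_image_fiber_le h₁
      · exact sum_card_image_fiber_le h₂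

end Counting

theorem card_pi_fin_subtype {ι : Type*} [Fintype ι] [DecidableEq ι] (M : ι → ℕ) (p : ι → Prop)
    [DecidablePred p] :
    Fintype.card (∀ i : {i // p i}, Fin (M i)) = ∏ i with p i, M i := by
  rw [Fintype.card_pi]
  simp only [Fintype.card_fin]
  exact (Finset.prod_subtype _ (fun i => by simp) M).symm

theorem card_filter_restrict_eq_le {ι : Type*} [Fintype ι] {M : ι → ℕ}
    (p : ι → Prop) [DecidablePred p] (G : Finset (∀ i, Fin (M i)))
    (a : ∀ i : {i // p i}, Fin (M i)) :
    (G.filter fun m => (fun i : {i // p i} => m i) = a).card ≤ ∏ i with ¬ p i, M i := by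
  classical
  rw [← card_pi_fin_subtype, ← Finset.card_univ]
  refine Finset.card_le_card_of_injOn (fun m i => m i) (fun _ _ => Finset.mem_univ _)
    fun m hm m' hm' h => funext fun i => ?_
  have hma := (Finset.mem_filter.1 hm).2.trans (Finset.mem_filter.1 hm').2.symm
  by_cases hi : p i
  · exact congrFun hma ⟨i, hi⟩
  · exact congrFun h ⟨i, hi⟩

open Classical in
theorem Code.card_le_two_mul_card_correct {w : Finset (Fin K) → ℕ} {M : E → ℕ}
    (c : Code (combChannel w) E M) (hM : ∀ S, 0 < M S) (hc : c.errorProb ≤ 1 / 2) :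
    ∏ S, M S ≤ 2 * (Finset.univ.filter fun m => c.Correct m).card := by
  have hcard : Fintype.card (∀ S : E, Fin (M S)) = ∏ S, M S := by simp [Fintype.card_pi]
  have hpos : (0 : ℝ) < (∏ S, M S : ℕ) := Nat.cast_pos.2 (Finset.prod_pos fun S _ => hM S)
  have hadd := Finset.card_filter_add_card_filter_not (s := Finset.univ) fun m => c.Correct m
  rw [Finset.card_univ, hcard] at hadd
  rw [c.errorProb_combChannel, hcard, div_le_iff₀ hpos, ← hadd, Nat.cast_add] at hc
  have hle : ((Finset.univ.filter fun m => ¬ c.Correct m).card : ℝ) ≤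
      (Finset.univ.filter fun m => c.Correct m).card := by linarith
  have := Nat.cast_le.1 hle
  omega

theorem Code.Correct.eq_of_observe_eq_of_observe_eq {w : Finset (Fin K) → ℕ} {M : E → ℕ}
    {c : Code (combChannel w) E M} {m m' : ∀ S : E, Fin (M S)} (h : c.Correct m)
    (h' : c.Correct m') {p q j : Fin K} (hp : observe p (c.enc m) = observe p (c.enc m'))
    (hq : observe q (c.enc m) = observe q (c.enc m'))
    (hrest : ∀ S : P K, j ∈ S.1 → p ∉ S.1 → q ∉ S.1 → c.enc m S = c.enc m' S)
    (hm : ∀ S : E, j ∉ S.1 → m S = m' S) : m = m' := by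
  have hj : observe j (c.enc m) = observe j (c.enc m') := observe_eq_iff.2 fun S hS => by
    by_cases hpS : p ∈ S.1
    · exact observe_eq_iff.1 hp S hpS
    by_cases hqS : q ∈ S.1
    · exact observe_eq_iff.1 hq S hqS
    exact hrest S hS hpS hqS
  funext S
  by_cases hS : j ∈ S.1
  · exact h.eq_of_observe_eq h' hj hS
  · exact hm S hS

/-- Receivers `p` and `q` both decode the messages intended for both of them, and a receiver `j`
that is told in addition what `p` and `q` see only needs its remaining links. -/
theorem Code.prod_mul_prod_le {w : Finset (Fin K) → ℕ} {M : E → ℕ}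
    (c : Code (combChannel w) E M) (hM : ∀ S, 0 < M S) (hc : c.errorProb ≤ 1 / 2) (p q j : Fin K) :
    (∏ S : E with p ∈ S.1 ∧ q ∈ S.1, M S) * ∏ S : E with j ∈ S.1, M S ≤
      4 * (numVals w (W p (P K)) * numVals w (W q (P K)) *
        numVals w ((W j (P K)).filter fun S => p ∉ S ∧ q ∉ S)) := by
  classical
  set rest := (W j (P K)).filter fun S => p ∉ S ∧ q ∉ S
  have hG := c.card_le_two_mul_card_correct hM hc
  set G := Finset.univ.filter fun m => c.Correct m
  have hcorrect : ∀ m ∈ G, c.Correct m := fun m h => (Finset.mem_filter.1 h).2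
  have hsq := sq_card_le_of_determines
    (card_filter_restrict_eq_le (fun S : E => p ∈ S.1 ∧ q ∈ S.1) G)
    (f₁ := fun m => observe p (c.enc m)) (f₂ := fun m => observe q (c.enc m))
    (g := fun m => ((fun S : {S : E // j ∉ S.1} => m S),
      fun S : rest => observe j (c.enc m) ⟨S, Finset.filter_subset _ _ S.2⟩))
    (fun m hm m' hm' h => funext fun S =>
      (hcorrect m hm).eq_of_observe_eq (hcorrect m' hm') h S.2.1)
    (fun m hm m' hm' h => funext fun S =>
      (hcorrect m hm).eq_of_observe_eq (hcorrect m' hm') h S.2.2)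
    fun m hm m' hm' hp hq hg =>
      (hcorrect m hm).eq_of_observe_eq_of_observe_eq (hcorrect m' hm') hp hq
        (fun S hj hpS hqS => congrFun (Prod.mk.inj hg).2
          ⟨S, Finset.mem_filter.2 ⟨Finset.mem_filter.2 ⟨S.2, hj⟩, hpS, hqS⟩⟩)
        fun S hS => congrFun (Prod.mk.inj hg).1 ⟨S, hS⟩
  rw [Fintype.card_prod, card_pi_fin_subtype, card_pi_links, card_pi_links, card_pi_links] at hsq
  have hpq := Finset.prod_filter_mul_prod_filter_not Finset.univ
    (fun S : E => p ∈ S.1 ∧ q ∈ S.1) M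
  have hj := Finset.prod_filter_mul_prod_filter_not Finset.univ (fun S : E => j ∈ S.1) M
  have hpos : 0 < (∏ S : E with ¬ (p ∈ S.1 ∧ q ∈ S.1), M S) * ∏ S : E with j ∉ S.1, M S :=
    Nat.mul_pos (Finset.prod_pos fun S _ => hM S) (Finset.prod_pos fun S _ => hM S)
  refine Nat.le_of_mul_le_mul_right ?_ hpos
  calc _ = (∏ S, M S) * ∏ S, M S := by rw [mul_mul_mul_comm, hpq, hj]
    _ ≤ (2 * G.card) * (2 * G.card) := Nat.mul_le_mul hG hG
    _ = 4 * G.card ^ 2 := by ring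
    _ ≤ 4 * _ := Nat.mul_le_mul_left 4 hsq
    _ = _ := by ring

/-- The case `p = q = j` is the cut-set bound for receiver `j`. -/
theorem Achievable.sum_add_sum_le {C : Finset (Fin K) → ℝ} {w : ℕ → Finset (Fin K) → ℕ}
    (hw : LinkSizes C w) {R : E → ℝ} (h : Achievable (fun n => combChannel (w n)) E R)
    (p q j : Fin K) :
    ∑ S : E with p ∈ S.1 ∧ q ∈ S.1, R S + ∑ S : E with j ∈ S.1, R S ≤
      cap C (W p (P K)) + cap C (W q (P K)) +
        cap C ((W j (P K)).filter fun S => p ∉ S ∧ q ∉ S) := by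
  obtain ⟨hR, c, hc⟩ := h
  have hev : ∀ᶠ n in atTop, (c n).errorProb ≤ 1 / 2 := hc.eventually_le_const (by norm_num)
  set pq := (Finset.univ : Finset E).filter fun S => p ∈ S.1 ∧ q ∈ S.1
  set cj := (Finset.univ : Finset E).filter fun S => j ∈ S.1
  set rest := (W j (P K)).filter fun S => p ∉ S ∧ q ∉ S
  refine le_of_eventually_two_rpow_le (c := 2 ^ pq.card * 2 ^ cj.card * 4)
    (hev.mono fun n hn => ?_)
  set M : E → ℕ := fun S => ⌊(2 : ℝ) ^ ((n : ℝ) * R S)⌋₊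
  have hcode : ((∏ S ∈ pq, M S : ℕ) : ℝ) * (∏ S ∈ cj, M S : ℕ) ≤
      4 * (numVals (w n) (W p (P K)) * numVals (w n) (W q (P K)) * numVals (w n) rest) := by
    exact_mod_cast (c n).prod_mul_prod_le (fun S => floor_two_rpow_pos n (hR S)) hn p q j
  calc (2 : ℝ) ^ ((n : ℝ) * (∑ S ∈ pq, R S + ∑ S ∈ cj, R S))
      = 2 ^ ((n : ℝ) * ∑ S ∈ pq, R S) * 2 ^ ((n : ℝ) * ∑ S ∈ cj, R S) := by
        rw [mul_add, Real.rpow_add two_pos]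
    _ ≤ (2 ^ pq.card * (∏ S ∈ pq, M S : ℕ)) * (2 ^ cj.card * (∏ S ∈ cj, M S : ℕ)) :=
        mul_le_mul (two_rpow_sum_le_prod_floor n _ fun S _ => hR S)
          (two_rpow_sum_le_prod_floor n _ fun S _ => hR S) (by positivity) (by positivity)
    _ = 2 ^ pq.card * 2 ^ cj.card * ((∏ S ∈ pq, M S : ℕ) * (∏ S ∈ cj, M S : ℕ)) := by ring
    _ ≤ 2 ^ pq.card * 2 ^ cj.card * (4 * (2 ^ ((n : ℝ) * cap C (W p (P K))) *
          2 ^ ((n : ℝ) * cap C (W q (P K))) * 2 ^ ((n : ℝ) * cap C rest))) := by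
        grw [hcode, hw.numVals_le W_subset n, hw.numVals_le W_subset n,
          hw.numVals_le ((Finset.filter_subset _ _).trans W_subset) n]
    _ = _ := by rw [mul_add, mul_add, Real.rpow_add two_pos, Real.rpow_add two_pos]; ring

theorem Achievable.sum_le_cap {C : Finset (Fin K) → ℝ} {w : ℕ → Finset (Fin K) → ℕ}
    (hw : LinkSizes C w) {R : E → ℝ} (h : Achievable (fun n => combChannel (w n)) E R)
    (j : Fin K) : ∑ S : E with j ∈ S.1, R S ≤ cap C (W j (P K)) := by
  have hbound := h.sum_add_sum_le hw j j j
  have hempty : ((W j (P K)).filter fun S => j ∉ S) = ∅ :=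
    Finset.filter_eq_empty_iff.2 fun S hS => not_not.2 (Finset.mem_filter.1 hS).2
  have hzero : cap C ∅ = 0 := Finset.sum_empty
  simp only [and_self, hempty, hzero] at hbound
  linarith

/-! ### Two nested messages -/

/-- The index of the common message. -/
abbrev commonIdx (K : ℕ) : nested K := ⟨Finset.univ, by simp [nested]⟩

/-- The index of the private message. -/
abbrev privIdx (K : ℕ) : nested K := ⟨privRecv K, by simp [nested]⟩

theorem mem_privRecv {k : Fin K} : k ∈ privRecv K ↔ k ∉ commonRecv K := Finset.mem_compl

theorem exists_commonRecv_eq (hK : 2 ≤ K) : ∃ p q : Fin K, p ≠ q ∧ commonRecv K = {p, q} := by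
  refine ⟨⟨K - 2, by omega⟩, ⟨K - 1, by omega⟩, ?_, ?_⟩
  · rw [Ne, Fin.mk.injEq]
    omega
  · ext i
    have := i.2
    simp only [commonRecv, Finset.mem_filter, Finset.mem_univ, true_and, Finset.mem_insert,
      Finset.mem_singleton, Fin.ext_iff]
    omega

theorem privRecv_nonempty (hK : 3 ≤ K) : (privRecv K).Nonempty :=
  ⟨⟨0, by omega⟩, by simp only [mem_privRecv, commonRecv, Finset.mem_filter]; omega⟩

theorem univ_ne_privRecv (hK : 2 ≤ K) : Finset.univ ≠ privRecv K := by
  obtain ⟨p, q, -, hpq⟩ := exists_commonRecv_eq hK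
  intro h
  exact mem_privRecv.1 (h ▸ Finset.mem_univ p) (by simp [hpq])

theorem commonIdx_ne_privIdx (hK : 2 ≤ K) : commonIdx K ≠ privIdx K := fun h =>
  univ_ne_privRecv hK (congrArg Subtype.val h)

theorem eq_commonIdx_or_eq_privIdx (S : nested K) : S = commonIdx K ∨ S = privIdx K := by
  obtain ⟨S, hS⟩ := S
  rcases Finset.mem_insert.1 hS with rfl | hS
  · exact Or.inr rfl
  · exact Or.inl (Subtype.ext (Finset.mem_singleton.1 hS))

theorem sum_nested (hK : 2 ≤ K) (f : nested K → ℝ) :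
    ∑ S, f S = f (commonIdx K) + f (privIdx K) := by
  have huniv : (Finset.univ : Finset (nested K)) = {commonIdx K, privIdx K} := by
    ext S
    simpa using eq_commonIdx_or_eq_privIdx S
  rw [huniv, Finset.sum_pair (commonIdx_ne_privIdx hK)]

theorem sum_filter_mem_nested (hK : 2 ≤ K) (R : nested K → ℝ) (k : Fin K) :
    ∑ S : nested K with k ∈ S.1, R S = rateC R + if k ∈ privRecv K then rateP R else 0 := by
  rw [Finset.sum_filter, sum_nested hK, if_pos (Finset.mem_univ k)]
  rfl

theorem subset_privRecv_iff {p q : Fin K} (hpq : commonRecv K = {p, q}) {S : Finset (Fin K)} :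
    S ⊆ privRecv K ↔ p ∉ S ∧ q ∉ S := by
  rw [privRecv, hpq, Finset.subset_compl_comm, Finset.insert_subset_iff]
  simp

theorem downIn_privRecv {p q : Fin K} (hpq : commonRecv K = {p, q}) (j : Fin K) :
    downIn (W j (P K)) {privRecv K} = (W j (P K)).filter fun S => p ∉ S ∧ q ∉ S := by
  ext S
  simp only [downIn, down, W, Finset.mem_inter, Finset.mem_filter, Finset.mem_singleton,
    exists_eq_left, subset_privRecv_iff hpq]
  tauto

theorem Achievable.mem_region (hK : 2 ≤ K) {C : Finset (Fin K) → ℝ}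
    {w : ℕ → Finset (Fin K) → ℕ} (hw : LinkSizes C w) {R : nested K → ℝ}
    (h : Achievable (fun n => combChannel (w n)) (nested K) R) : R ∈ region C := by
  obtain ⟨p, q, hne, hpq⟩ := exists_commonRecv_eq hK
  have hcut : ∀ k, rateC R + (if k ∈ privRecv K then rateP R else 0) ≤ cap C (W k (P K)) :=
    fun k => sum_filter_mem_nested hK R k ▸ h.sum_le_cap hw k
  refine ⟨h.1 _, h.1 _, fun i hi => ?_, fun j hj => ?_, fun j hj => ?_⟩
  · simpa [mem_privRecv, hi] using hcut i
  · simpa [hj] using hcut j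
  · have hpq_mem : ∀ S : nested K, p ∈ S.1 ∧ q ∈ S.1 ↔ S = commonIdx K := by
      intro S
      rcases eq_commonIdx_or_eq_privIdx S with rfl | rfl
      · simp
      · simp [mem_privRecv, hpq, (commonIdx_ne_privIdx hK).symm]
    have hbound := h.sum_add_sum_le hw p q j
    simp only [hpq_mem, Finset.filter_eq', Finset.mem_univ, if_true, Finset.sum_singleton,
      sum_filter_mem_nested hK, hj] at hbound
    rw [hpq, Finset.sum_pair hne, downIn_privRecv hpq]
    change rateC R + _ ≤ _ at hbound
    linarith

theorem isClosed_region (C : Finset (Fin K) → ℝ) : IsClosed (region C) := by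
  have hc : Continuous fun R : nested K → ℝ => rateC R := continuous_apply _
  have hp : Continuous fun R : nested K → ℝ => rateP R := continuous_apply _
  simp only [region, Set.ofPred_and, Set.ofPred_forall]
  refine (isClosed_le continuous_const hc).inter ((isClosed_le continuous_const hp).inter
    (IsClosed.inter ?_ (IsClosed.inter ?_ ?_))) <;>
  exact isClosed_biInter fun i _ => isClosed_le (by fun_prop) continuous_const

theorem capacityRegion_subset_region (hK : 2 ≤ K) {C : Finset (Fin K) → ℝ}
    {w : ℕ → Finset (Fin K) → ℕ} (hw : LinkSizes C w) :
    capacityRegion (fun n => combChannel (w n)) (nested K) ⊆ region C :=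
  closure_minimal (fun _ h => Achievable.mem_region hK hw h) (isClosed_region C)

/-! ### Random superposition coding -/

open scoped BigOperators

theorem expect_prod_pi {ι : Type*} [Fintype ι] [DecidableEq ι] {Ω : ι → Type*}
    [∀ i, Fintype (Ω i)] (F : ∀ i, Ω i → ℝ) :
    𝔼 ω : (∀ i, Ω i), ∏ i, F i (ω i) = ∏ i, 𝔼 x, F i x := by
  simp only [Fintype.expect_eq_sum_div_card, Finset.prod_div_distrib, Fintype.card_pi,
    Nat.cast_prod]
  rw [Finset.prod_univ_sum, Fintype.piFinset_univ]

theorem expect_apply_eq_apply {D Y : Type*} [Fintype D] [DecidableEq D] [Fintype Y]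
    [DecidableEq Y] [Nonempty Y] {d d' : D} (h : d ≠ d') :
    𝔼 g : D → Y, (if g d = g d' then (1 : ℝ) else 0) = (Fintype.card Y : ℝ)⁻¹ := by
  calc _ = 𝔼 z : Y × ({j // j ≠ d} → Y), if z.1 = z.2 ⟨d', h.symm⟩ then (1 : ℝ) else 0 :=
        Fintype.expect_equiv (Equiv.funSplitAt d Y) _ _ fun g => rfl
    _ = (Fintype.card Y : ℝ)⁻¹ := by
        rw [← Finset.univ_product_univ, Finset.expect_product, Finset.expect_comm]
        simp

theorem mem_downIn_image_iff {ι : Type*} [Fintype ι] {lab : ι → Finset (Fin K)} {α : ι → Type*}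
    [∀ i, DecidableEq (α i)] (k : Fin K) (m m' : ∀ i, α i) (S : P K) :
    S.1 ∈ downIn (W k (P K)) (({i | m i ≠ m' i} : Finset ι).image lab) ↔
      k ∈ S.1 ∧
        (fun i : {i // S.1 ⊆ lab i} => m i) ≠ fun i : {i // S.1 ⊆ lab i} => m' i := by
  have hS := S.2
  simp only [downIn, down, W, Finset.mem_inter, Finset.mem_filter, Finset.mem_image,
    Finset.mem_univ, true_and, exists_exists_and_eq_and, Function.ne_iff, Subtype.exists,
    hS]
  tauto

section Superposition

variable {ι : Type} [Fintype ι] [DecidableEq ι] {lab : ι → Finset (Fin K)} {α : ι → Type}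
  [∀ i, Fintype (α i)] {w : Finset (Fin K) → ℕ}

variable (lab α w) in
/-- A codebook for superposition coding of message parts `i : ι` with values in `α i`: the link to
`V_S` carries a function of the parts whose label contains `S`. -/
abbrev Codebook : Type := ∀ S : P K, (∀ i : {i // S.1 ⊆ lab i}, α i) → Fin (w S)

/-- The link values that the codebook `G` assigns to the message parts `m`. -/
def Codebook.encode (G : Codebook lab α w) (m : ∀ i, α i) (S : P K) : Fin (w S) :=
  G S fun i => m i

/-- Some receiver cannot tell the values of the parts intended for it, those whose label contains
the receiver, from the link values it sees. -/
def Codebook.Ambiguous (G : Codebook lab α w) (m : ∀ i, α i) : Prop :=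
  ∃ k m', observe k (G.encode m) = observe k (G.encode m') ∧ ∃ i, k ∈ lab i ∧ m' i ≠ m i

theorem expect_observe_encode_eq [∀ i, DecidableEq (α i)] (hw : ∀ S ∈ P K, 0 < w S) (k : Fin K)
    (m m' : ∀ i, α i) :
    𝔼 G : Codebook lab α w,
      (if observe k (G.encode m) = observe k (G.encode m') then (1 : ℝ) else 0) =
      (numVals w (downIn (W k (P K)) (({i | m i ≠ m' i} : Finset ι).image lab)) : ℝ)⁻¹ := by
  set F := downIn (W k (P K)) (({i | m i ≠ m' i} : Finset ι).image lab)
  have hF : F ⊆ P K := Finset.inter_subset_right.trans W_subset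
  have hlink : ∀ S : P K,
      𝔼 g : (∀ i : {i // S.1 ⊆ lab i}, α i) → Fin (w S),
        (if k ∈ S.1 → g (fun i => m i) = g fun i => m' i then (1 : ℝ) else 0) =
      if S.1 ∈ F then (w S : ℝ)⁻¹ else 1 := fun S => by
    have : Nonempty (Fin (w S)) := ⟨0, hw S S.2⟩
    rw [if_congr (mem_downIn_image_iff k m m' S) rfl rfl]
    split_ifs with h
    · simp only [h.1, true_imp_iff, expect_apply_eq_apply h.2, Fintype.card_fin]
    · refine (Finset.expect_congr rfl fun g _ => if_pos fun hk => ?_).trans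
        (Fintype.expect_const 1)
      rw [not_ne_iff.1 fun hne => h ⟨hk, hne⟩]
  calc _ = 𝔼 G : Codebook lab α w, ∏ S : P K,
        if k ∈ S.1 → G S (fun i => m i) = G S fun i => m' i then (1 : ℝ) else 0 := by
        refine Finset.expect_congr rfl fun G _ => ?_
        simp only [Finset.prod_ite_zero, Finset.prod_const_one, observe_eq_iff, Finset.mem_univ,
          true_imp_iff, Codebook.encode]
    _ = ∏ S : P K, if S.1 ∈ F then (w S : ℝ)⁻¹ else 1 := by
        rw [expect_prod_pi fun (S : P K) (g : (∀ i : {i // S.1 ⊆ lab i}, α i) → Fin (w S)) =>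
          if k ∈ S.1 → g (fun i => m i) = g fun i => m' i then (1 : ℝ) else 0]
        exact Finset.prod_congr rfl fun S _ => hlink S
    _ = (numVals w F : ℝ)⁻¹ := by
        rw [Finset.prod_coe_sort (P K) fun S => if S ∈ F then (w S : ℝ)⁻¹ else 1,
          Finset.prod_ite_mem, Finset.inter_eq_right.2 hF,
          Finset.prod_inv_distrib, numVals, Nat.cast_prod]

/-- The values of the message parts that differ from `m` exactly on `D`. -/
def changedOn [∀ i, DecidableEq (α i)] (m : ∀ i, α i) (D : Finset ι) : Finset (∀ i, α i) :=
  {m' | ({i | m i ≠ m' i} : Finset ι) = D}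

theorem card_changedOn [∀ i, DecidableEq (α i)] (m : ∀ i, α i) (D : Finset ι) :
    (changedOn m D).card = ∏ i ∈ D, (Fintype.card (α i) - 1) := by
  have hpi : changedOn m D =
      Fintype.piFinset fun i => if i ∈ D then Finset.univ.erase (m i) else {m i} := by
    ext m'
    simp only [changedOn, Finset.mem_filter, Finset.mem_univ, true_and, Finset.ext_iff,
      Fintype.mem_piFinset]
    refine forall_congr' fun i => ?_
    split_ifs with hi <;> simp [hi, eq_comm]
  rw [hpi, Fintype.card_piFinset]
  simp [apply_ite, Finset.prod_ite_mem]

/-- Only the parts intended for receiver `k` matter to it, so the others may be left unchanged. -/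
theorem Codebook.Ambiguous.exists_changedOn [∀ i, DecidableEq (α i)] {G : Codebook lab α w}
    {m : ∀ i, α i} (h : G.Ambiguous m) : ∃ k, ∃ D : Finset ι, (∀ i ∈ D, k ∈ lab i) ∧ D.Nonempty ∧
      ∃ m' ∈ changedOn m D, observe k (G.encode m) = observe k (G.encode m') := by
  obtain ⟨k, m', hobs, i, hki, hi⟩ := h
  set m'' : ∀ i, α i := fun i => if k ∈ lab i then m' i else m i with hm''
  refine ⟨k, ({i | m i ≠ m'' i} : Finset ι), fun i hi => ?_, ⟨i, ?_⟩, m'',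
    by simp [changedOn], hobs.trans ?_⟩
  · by_contra hk
    simp [hm'', hk] at hi
  · simpa [hm'', hki] using hi.symm
  · refine observe_eq_iff.2 fun S hS => congrArg (G S) (funext fun i => ?_)
    exact (if_pos (i.2 hS)).symm

variable (lab α w) in
/-- The union bound on the probability that a random codebook is ambiguous at given message parts:
receiver `k` may confuse the parts in `D`, all intended for it, with any wrong values of these
parts, and the links that tell the values apart are those below the labels of `D`. -/
noncomputable def ambiguityBound : ℝ :=
  ∑ k : Fin K, ∑ D : Finset ι with (∀ i ∈ D, k ∈ lab i) ∧ D.Nonempty,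
    (∏ i ∈ D, (Fintype.card (α i) - 1) : ℕ) / (numVals w (downIn (W k (P K)) (D.image lab)) : ℝ)

open Classical in
theorem expect_ambiguous_le [∀ i, DecidableEq (α i)] (hw : ∀ S ∈ P K, 0 < w S)
    (m : ∀ i, α i) :
    𝔼 G : Codebook lab α w, (if G.Ambiguous m then (1 : ℝ) else 0) ≤ ambiguityBound lab α w := by
  have hunion : ∀ G : Codebook lab α w, (if G.Ambiguous m then (1 : ℝ) else 0) ≤
      ∑ k : Fin K, ∑ D : Finset ι with (∀ i ∈ D, k ∈ lab i) ∧ D.Nonempty, ∑ m' ∈ changedOn m D,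
        if observe k (G.encode m) = observe k (G.encode m') then (1 : ℝ) else 0 := fun G => by
    split_ifs with h
    · obtain ⟨k, D, hk, hD, m', hm', hobs⟩ := h.exists_changedOn
      refine le_trans ?_ (Finset.single_le_sum (fun _ _ => by positivity) (Finset.mem_univ k))
      refine le_trans ?_ (Finset.single_le_sum (fun _ _ => by positivity)
        (Finset.mem_filter.2 ⟨Finset.mem_univ D, hk, hD⟩))
      refine le_trans ?_ (Finset.single_le_sum (fun _ _ => by positivity) hm')
      exact (if_pos hobs).ge
    · positivity
  calc _ ≤ 𝔼 G : Codebook lab α w, ∑ k : Fin K,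
        ∑ D : Finset ι with (∀ i ∈ D, k ∈ lab i) ∧ D.Nonempty, ∑ m' ∈ changedOn m D,
        if observe k (G.encode m) = observe k (G.encode m') then (1 : ℝ) else 0 :=
        Finset.expect_le_expect fun G _ => hunion G
    _ = ambiguityBound lab α w := by
        simp only [Finset.expect_sum_comm, expect_observe_encode_eq hw]
        refine Finset.sum_congr rfl fun k _ => Finset.sum_congr rfl fun D _ => ?_
        rw [Finset.sum_congr rfl fun m' hm' => by rw [(Finset.mem_filter.1 hm').2],
          Finset.sum_const, card_changedOn, nsmul_eq_mul, div_eq_mul_inv]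

open Classical in
theorem exists_codebook_card_ambiguous_le (hw : ∀ S ∈ P K, 0 < w S) {Ω : Type*} [Fintype Ω]
    (μ : Ω → ∀ i, α i) : ∃ G : Codebook lab α w,
      ((Finset.univ.filter fun ω => G.Ambiguous (μ ω)).card : ℝ) ≤
        Fintype.card Ω * ambiguityBound lab α w := by
  have : ∀ S : P K, Nonempty (Fin (w S)) := fun S => ⟨0, hw S S.2⟩
  have hmean : 𝔼 G : Codebook lab α w, ((Finset.univ.filter fun ω => G.Ambiguous (μ ω)).card : ℝ)
      ≤ Fintype.card Ω * ambiguityBound lab α w := by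
    simp only [← Finset.sum_boole, Finset.expect_sum_comm]
    refine (Finset.sum_le_card_nsmul _ _ _ fun ω _ => expect_ambiguous_le hw (μ ω)).trans_eq ?_
    rw [Finset.card_univ, nsmul_eq_mul]
  obtain ⟨G, -, hG⟩ := Finset.exists_le_of_expect_le Finset.univ_nonempty hmean
  exact ⟨G, hG⟩

end Superposition

/-! ### Rate splitting -/

open Classical in
theorem exists_code_errorProb_le_ambiguityBound {w : Finset (Fin K) → ℕ}
    (hw : ∀ S ∈ P K, 0 < w S) {M : E → ℕ} (hM : ∀ S, 0 < M S) {N : E → Finset (Fin K) → ℕ}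
    (hN : ∀ S, M S ≤ ∏ T, N S T) (hsub : ∀ S T, 1 < N S T → S.1 ⊆ T) :
    ∃ c : Code (combChannel w) E M,
      c.errorProb ≤ ambiguityBound Prod.snd (fun i : E × Finset (Fin K) => Fin (N i.1 i.2)) w := by
  have hsplit : ∀ S, ∃ σ : Fin (M S) → ∀ T, Fin (N S T), Function.Injective σ := fun S => by
    obtain ⟨σ⟩ := Function.Embedding.nonempty_of_card_le (α := Fin (M S)) (β := ∀ T, Fin (N S T))
      (by simpa using hN S)
    exact ⟨σ, σ.injective⟩
  choose σ hσ using hsplit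
  set parts : (∀ S, Fin (M S)) → ∀ i : E × Finset (Fin K), Fin (N i.1 i.2) :=
    fun m i => σ i.1 (m i.1) i.2
  obtain ⟨G, hG⟩ := exists_codebook_card_ambiguous_le (lab := Prod.snd) hw parts
  obtain ⟨c, hc⟩ := exists_code_of_enc hM fun m => G.encode (parts m)
  have : ∀ S, Nonempty (Fin (M S)) := fun S => ⟨0, hM S⟩
  refine ⟨c, hc.trans ?_⟩
  rw [div_le_iff₀' (Nat.cast_pos.2 Fintype.card_pos)]
  refine le_trans (Nat.cast_le.2 (Finset.card_le_card fun m hm => ?_)) hG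
  obtain ⟨k, m', hobs, S, hkS, hS⟩ := (Finset.mem_filter.1 hm).2
  obtain ⟨T, hT⟩ := Function.ne_iff.1 ((hσ S).ne hS)
  have hone : 1 < N S T := by
    simpa using Fintype.one_lt_card_iff.2 ⟨_, _, hT⟩
  exact Finset.mem_filter.2 ⟨Finset.mem_univ m, k, parts m', hobs, (S, T), hsub S T hone hkS, hT⟩

theorem tendsto_two_rpow_nat_mul {r : ℝ} (hr : r < 0) :
    Tendsto (fun n : ℕ => (2 : ℝ) ^ ((n : ℝ) * r)) atTop (𝓝 0) := by
  simp only [two_rpow_nat_mul]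
  exact tendsto_pow_atTop_nhds_zero_of_lt_one (by positivity)
    (Real.rpow_lt_one_of_one_lt_of_neg one_lt_two hr)

theorem prod_ceil_two_rpow_sub_one_le {ι : Type*} (n : ℕ) (s : Finset ι) (r : ι → ℝ) :
    ((∏ i ∈ s, (⌈(2 : ℝ) ^ ((n : ℝ) * r i)⌉₊ - 1) : ℕ) : ℝ) ≤ 2 ^ ((n : ℝ) * ∑ i ∈ s, r i) := by
  rw [two_rpow_nat_mul_sum, Nat.cast_prod]
  refine Finset.prod_le_prod (fun _ _ => Nat.cast_nonneg _) fun i _ => ?_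
  rw [Nat.cast_pred (Nat.ceil_pos.2 (by positivity)), sub_le_iff_le_add]
  exact (Nat.ceil_lt_add_one (by positivity)).le

theorem LinkSizes.div_numVals_le {C : Finset (Fin K) → ℝ} {w : ℕ → Finset (Fin K) → ℕ}
    (hw : LinkSizes C w) {F : Finset (Finset (Fin K))} (hF : F ⊆ P K) {n : ℕ} {N r : ℝ}
    (hN : N ≤ 2 ^ ((n : ℝ) * r)) :
    N / numVals (w n) F ≤ 2 ^ F.card * 2 ^ ((n : ℝ) * (r - cap C F)) := by
  have hpos : (0 : ℝ) < numVals (w n) F :=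
    Nat.cast_pos.2 (Finset.prod_pos fun S hS => hw.pos n (hF hS))
  rw [div_le_iff₀ hpos]
  calc N ≤ 2 ^ ((n : ℝ) * (r - cap C F)) * 2 ^ ((n : ℝ) * cap C F) := by
        rwa [← Real.rpow_add two_pos, ← mul_add, sub_add_cancel]
    _ ≤ 2 ^ ((n : ℝ) * (r - cap C F)) * (2 ^ F.card * numVals (w n) F) := by
        grw [hw.le_numVals hF n]
    _ = _ := by ring

theorem tendsto_ambiguityBound {ι : Type} [Fintype ι] [DecidableEq ι] {lab : ι → Finset (Fin K)}
    {C : Finset (Fin K) → ℝ} {w : ℕ → Finset (Fin K) → ℕ} (hw : LinkSizes C w) {r : ι → ℝ}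
    (hr : ∀ i, 0 ≤ r i)
    (hcap : ∀ (k : Fin K) (D : Finset ι), D.Nonempty → (∀ i ∈ D, k ∈ lab i ∧ 0 < r i) →
      ∑ i ∈ D, r i < cap C (downIn (W k (P K)) (D.image lab))) :
    Tendsto (fun n : ℕ => ambiguityBound lab (fun i => Fin ⌈(2 : ℝ) ^ ((n : ℝ) * r i)⌉₊) (w n))
      atTop (𝓝 0) := by
  have hzero : ∑ k : Fin K, ∑ D : Finset ι with (∀ i ∈ D, k ∈ lab i) ∧ D.Nonempty, (0 : ℝ) =
      0 := by simp only [Finset.sum_const_zero]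
  rw [← congrArg 𝓝 hzero]
  refine tendsto_finsetSum _ fun k _ => tendsto_finsetSum _ fun D hD => ?_
  obtain ⟨hk, hne⟩ := (Finset.mem_filter.1 hD).2
  simp only [Fintype.card_fin]
  by_cases hpos : ∀ i ∈ D, 0 < r i
  · have hlim := (tendsto_two_rpow_nat_mul
      (sub_neg.2 (hcap k D hne fun i hi => ⟨hk i hi, hpos i hi⟩))).const_mul
      ((2 : ℝ) ^ (downIn (W k (P K)) (D.image lab)).card)
    rw [mul_zero] at hlim
    exact squeeze_zero (fun n => by positivity) (fun n => hw.div_numVals_le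
      (Finset.inter_subset_right.trans W_subset) (prod_ceil_two_rpow_sub_one_le n D r)) hlim
  · push Not at hpos
    obtain ⟨i, hi, hri⟩ := hpos
    refine tendsto_const_nhds.congr fun n => ?_
    rw [Finset.prod_eq_zero hi (by simp [hri.antisymm (hr i)]), Nat.cast_zero, zero_div]

theorem achievable_of_rateSplitting {C : Finset (Fin K) → ℝ} {w : ℕ → Finset (Fin K) → ℕ}
    (hw : LinkSizes C w) {r : E → Finset (Fin K) → ℝ} (hr : ∀ S T, 0 ≤ r S T)
    (hsub : ∀ S T, r S T ≠ 0 → S.1 ⊆ T)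
    (hcap : ∀ (k : Fin K) (D : Finset (E × Finset (Fin K))), D.Nonempty →
      (∀ i ∈ D, k ∈ i.2 ∧ 0 < r i.1 i.2) →
      ∑ i ∈ D, r i.1 i.2 < cap C (downIn (W k (P K)) (D.image Prod.snd))) :
    Achievable (fun n => combChannel (w n)) E fun S => ∑ T, r S T := by
  have hR : ∀ S, 0 ≤ ∑ T, r S T := fun S => Finset.sum_nonneg fun T _ => hr S T
  have hN : ∀ (n : ℕ) (S : E), ⌊(2 : ℝ) ^ ((n : ℝ) * ∑ T, r S T)⌋₊ ≤
      ∏ T, ⌈(2 : ℝ) ^ ((n : ℝ) * r S T)⌉₊ := fun n S => by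
    refine Nat.floor_le_of_le ?_
    rw [two_rpow_nat_mul_sum, Nat.cast_prod]
    exact Finset.prod_le_prod (fun _ _ => by positivity) fun T _ => Nat.le_ceil _
  have hone : ∀ (n : ℕ) S T, 1 < ⌈(2 : ℝ) ^ ((n : ℝ) * r S T)⌉₊ → S.1 ⊆ T := fun n S T h =>
    hsub S T fun h0 => by simp [h0] at h
  choose c hc using fun n => exists_code_errorProb_le_ambiguityBound (fun S => hw.pos n)
    (fun S => floor_two_rpow_pos n (hR S)) (hN n) (hone n)
  refine ⟨hR, c, squeeze_zero (fun n => ?_) hc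
    (tendsto_ambiguityBound hw (fun i => hr i.1 i.2) hcap)⟩
  rw [Code.errorProb_combChannel]
  positivity

/-- The rate tuples attained by superposition coding with rate splitting: the message with index `S`
is split into parts with labels `T ⊇ S` and rates `r S T`, the parts with label `T` are decoded by
all receivers in `T`, and the link to `V_S` carries a function of the parts with labels `T ⊇ S`. -/
def superpositionRegion (C : Finset (Fin K) → ℝ) (E : Finset (Finset (Fin K))) : Set (E → ℝ) :=
  {R | ∃ r : E → Finset (Fin K) → ℝ, (∀ S T, 0 ≤ r S T) ∧ (∀ S T, r S T ≠ 0 → S.1 ⊆ T) ∧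
    (∀ S, ∑ T, r S T = R S) ∧
    ∀ k, ∀ Q ⊆ W k (P K), ∑ T ∈ Q, ∑ S, r S T ≤ cap C (downIn (W k (P K)) Q)}

theorem achievable_smul_of_mem_superpositionRegion {C : Finset (Fin K) → ℝ}
    {w : ℕ → Finset (Fin K) → ℕ} (hw : LinkSizes C w) {R : E → ℝ}
    (hR : R ∈ superpositionRegion C E) {θ : ℝ} (h0 : 0 < θ) (h1 : θ < 1) :
    Achievable (fun n => combChannel (w n)) E (θ • R) := by
  obtain ⟨r, hr, hsub, hsum, hcap⟩ := hR
  have hθR : θ • R = fun S => ∑ T, θ * r S T := funext fun S => by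
    rw [Pi.smul_apply, smul_eq_mul, ← hsum, Finset.mul_sum]
  rw [hθR]
  refine achievable_of_rateSplitting hw (fun S T => mul_nonneg h0.le (hr S T))
    (fun S T h => hsub S T (right_ne_zero_of_mul h)) fun k D hD hpos => ?_
  replace hpos : ∀ i ∈ D, k ∈ i.2 ∧ 0 < r i.1 i.2 := fun i hi =>
    (hpos i hi).imp_right (pos_of_mul_pos_right · h0.le)
  have hQ : D.image Prod.snd ⊆ W k (P K) := Finset.image_subset_iff.2 fun i hi => by
    have hk := (hpos i hi).1
    exact Finset.mem_filter.2 ⟨Finset.mem_filter.2 ⟨Finset.mem_univ _, k, hk⟩, hk⟩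
  have hsum_pos : 0 < ∑ i ∈ D, r i.1 i.2 := Finset.sum_pos (fun i hi => (hpos i hi).2) hD
  calc ∑ i ∈ D, θ * r i.1 i.2 = θ * ∑ i ∈ D, r i.1 i.2 := by rw [Finset.mul_sum]
    _ < ∑ i ∈ D, r i.1 i.2 := mul_lt_of_lt_one_left hsum_pos h1
    _ ≤ ∑ i ∈ Finset.univ ×ˢ D.image Prod.snd, r i.1 i.2 :=
        Finset.sum_le_sum_of_subset_of_nonneg
          (fun i hi => Finset.mem_product.2 ⟨Finset.mem_univ _, Finset.mem_image_of_mem _ hi⟩)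
          fun i _ _ => hr i.1 i.2
    _ = ∑ T ∈ D.image Prod.snd, ∑ S, r S T := Finset.sum_product_right _ _ _
    _ ≤ cap C (downIn (W k (P K)) (D.image Prod.snd)) := hcap k _ hQ

theorem superpositionRegion_subset_capacityRegion {C : Finset (Fin K) → ℝ}
    {w : ℕ → Finset (Fin K) → ℕ} (hw : LinkSizes C w) :
    superpositionRegion C E ⊆ capacityRegion (fun n => combChannel (w n)) E := fun R hR => by
  have hlim : Tendsto (fun θ : ℝ => θ • R) (𝓝[<] 1) (𝓝 R) := by
    have hcont : Continuous fun θ : ℝ => θ • R := by fun_prop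
    simpa using (hcont.tendsto 1).mono_left nhdsWithin_le_nhds
  refine mem_closure_of_tendsto hlim ?_
  filter_upwards [Ioo_mem_nhdsLT (zero_lt_one' ℝ)] with θ hθ
  exact achievable_smul_of_mem_superpositionRegion hw hR hθ.1 hθ.2

/-! ### Splitting the private message -/

/-- The part `z` is hidden from both `p` and `q`. The rates to be hidden from them are `α` and `β`;
overlapping the two as much as the smallest `d j` permits leaves the least total load `α + β - z`
for the private receivers. -/
theorem exists_private_split {ι : Type*} {s : Finset ι} (hs : s.Nonempty) {a b d : ι → ℝ}
    {T A B rc rp : ℝ} (ha : ∀ j ∈ s, 0 ≤ a j ∧ a j ≤ A) (hb : ∀ j ∈ s, 0 ≤ b j ∧ b j ≤ B)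
    (hd : ∀ j ∈ s, 0 ≤ d j) (hrp : 0 ≤ rp) (hA : rc ≤ T + A) (hB : rc ≤ T + B)
    (hsum : ∀ j ∈ s, rc + rp ≤ T + a j + (b j + d j))
    (hsum₂ : ∀ j ∈ s, 2 * rc + rp ≤ d j + ((T + A) + (T + B))) :
    ∃ u x y z : ℝ, (0 ≤ u ∧ 0 ≤ x ∧ 0 ≤ y ∧ 0 ≤ z) ∧ u + x + y + z = rp ∧
      (rc + u + x ≤ T + A ∧ x ≤ A) ∧ (rc + u + y ≤ T + B ∧ y ≤ B) ∧
      ∀ j ∈ s, x + y + z ≤ a j + (b j + d j) ∧ x + z ≤ a j + d j ∧ y + z ≤ b j + d j ∧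
        z ≤ d j := by
  obtain ⟨i, hi, hmin⟩ := s.exists_min_image d hs
  obtain ⟨ha0, haA⟩ := ha i hi
  obtain ⟨hb0, hbB⟩ := hb i hi
  set α := max 0 (rc + rp - (T + A))
  set β := max 0 (rc + rp - (T + B))
  set z := min (d i) (min α β)
  have hα : α = 0 ∨ α = rc + rp - (T + A) := max_choice _ _
  have hβ : β = 0 ∨ β = rc + rp - (T + B) := max_choice _ _
  obtain ⟨hα0, hαle⟩ : 0 ≤ α ∧ rc + rp - (T + A) ≤ α := max_le_iff.1 le_rfl
  obtain ⟨hβ0, hβle⟩ : 0 ≤ β ∧ rc + rp - (T + B) ≤ β := max_le_iff.1 le_rfl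
  obtain ⟨hzd, hzα, hzβ⟩ : z ≤ d i ∧ z ≤ α ∧ z ≤ β := by simp [z]
  have hz0 : 0 ≤ z := le_min (hd i hi) (le_min hα0 hβ0)
  have hαj : ∀ j ∈ s, α ≤ b j + d j := fun j hj =>
    max_le (by linarith [hb j hj, hd j hj]) (by linarith [ha j hj, hsum j hj])
  have hβj : ∀ j ∈ s, β ≤ a j + d j := fun j hj =>
    max_le (by linarith [ha j hj, hd j hj]) (by linarith [hb j hj, hsum j hj])
  have hxA : β - A ≤ z := le_min (by linarith [hβj i hi]) (le_min
    (sub_le_iff_le_add.2 (max_le (by linarith) (by linarith))) (by linarith))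
  have hyB : α - B ≤ z := le_min (by linarith [hαj i hi]) (le_min (by linarith)
    (sub_le_iff_le_add.2 (max_le (by linarith) (by linarith))))
  have hu : α + β - rp ≤ z := by
    have hα_rp : α ≤ rp := max_le hrp (by linarith)
    have hβ_rp : β ≤ rp := max_le hrp (by linarith)
    refine le_min ?_ (le_min (by linarith) (by linarith))
    rcases hα with hα | hα
    · linarith [hd i hi]
    · rcases hβ with hβ | hβ <;> linarith [hsum₂ i hi, hd i hi]
  have hxyz : ∀ j ∈ s, α + β - (a j + (b j + d j)) ≤ z := fun j hj => by
    refine le_min ?_ (le_min (by linarith [hβj j hj, hb j hj]) (by linarith [hαj j hj, ha j hj]))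
    rcases hα with hα | hα
    · linarith [hβj j hj, hb j hj]
    · rcases hβ with hβ | hβ
      · linarith [hβ, hαj j hj, ha j hj]
      · linarith [hα, hβ, hsum j hj, hsum₂ i hi]
  refine ⟨rp - (α + β - z), β - z, α - z, z, by grind, by ring, by grind, by grind,
    fun j hj => ⟨?_, ?_, ?_, hzd.trans (hmin j hj)⟩⟩
  · linarith [hxyz j hj]
  · linarith [hβj j hj]
  · linarith [hαj j hj]

/-! ### Achievability -/

/-- The rates of the parts labelled by all receivers, by the private receivers together with `p` or
`q`, and by the private receivers alone. -/
def labelRate (p q : Fin K) (v x y z : ℝ) (T : Finset (Fin K)) : ℝ :=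
  (if T = Finset.univ then v else 0) + (if T = insert p (privRecv K) then x else 0) +
    (if T = insert q (privRecv K) then y else 0) + if T = privRecv K then z else 0

theorem sum_labelRate (p q : Fin K) (v x y z : ℝ) (Q : Finset (Finset (Fin K))) :
    ∑ T ∈ Q, labelRate p q v x y z T =
      (if Finset.univ ∈ Q then v else 0) + (if insert p (privRecv K) ∈ Q then x else 0) +
        (if insert q (privRecv K) ∈ Q then y else 0) + if privRecv K ∈ Q then z else 0 := by
  simp only [labelRate, Finset.sum_add_distrib, Finset.sum_ite_eq']

theorem labelRate_nonneg {p q : Fin K} {v x y z : ℝ} (hv : 0 ≤ v) (hx : 0 ≤ x) (hy : 0 ≤ y)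
    (hz : 0 ≤ z) (T : Finset (Fin K)) : 0 ≤ labelRate p q v x y z T := by
  unfold labelRate
  positivity

theorem privRecv_subset_of_labelRate_ne_zero {p q : Fin K} {v x y z : ℝ} {T : Finset (Fin K)}
    (h : labelRate p q v x y z T ≠ 0) : privRecv K ⊆ T := by
  by_contra hT
  refine h ?_
  unfold labelRate
  rw [if_neg, if_neg, if_neg, if_neg, add_zero, add_zero, add_zero] <;> rintro rfl
  exacts [hT subset_rfl, hT (Finset.subset_insert _ _), hT (Finset.subset_insert _ _),
    hT (Finset.subset_univ _)]

theorem cap_filter_le_cap_downIn {C : Finset (Fin K) → ℝ} (hC : ∀ S ∈ P K, 0 ≤ C S)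
    {F Q : Finset (Finset (Fin K))} (hF : F ⊆ P K) (p : Finset (Fin K) → Prop) [DecidablePred p]
    (h : ∀ S, p S → ∃ T ∈ Q, S ⊆ T) : cap C (F.filter p) ≤ cap C (downIn F Q) := by
  refine Finset.sum_le_sum_of_subset_of_nonneg (fun S hS => ?_)
    fun S hS _ => hC S (hF (Finset.inter_subset_right hS))
  obtain ⟨hSF, hp⟩ := Finset.mem_filter.1 hS
  exact Finset.mem_inter.2 ⟨Finset.mem_filter.2 ⟨hF hSF, h S hp⟩, hSF⟩

theorem subset_insert_privRecv {p q : Fin K} (hpq : commonRecv K = {p, q}) {S : Finset (Fin K)}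
    (hq : q ∉ S) : S ⊆ insert p (privRecv K) := fun i hi => by
  rw [Finset.mem_insert, mem_privRecv, hpq, Finset.mem_insert, Finset.mem_singleton]
  have : i ≠ q := ne_of_mem_of_not_mem hi hq
  tauto

theorem sum_labelRate_le_cap_downIn {p q : Fin K} (hpq : commonRecv K = {p, q})
    {C : Finset (Fin K) → ℝ} (hC : ∀ S ∈ P K, 0 ≤ C S) {F : Finset (Finset (Fin K))}
    (hF : F ⊆ P K) {v x y z : ℝ} (hx : 0 ≤ x) (hy : 0 ≤ y) (hz : 0 ≤ z)
    (hvxyz : v + x + y + z ≤ cap C F)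
    (hxyz : x + y + z ≤ cap C (F.filter fun S => ¬ (p ∈ S ∧ q ∈ S)))
    (hxz : x + z ≤ cap C (F.filter fun S => q ∉ S))
    (hyz : y + z ≤ cap C (F.filter fun S => p ∉ S))
    (hz' : z ≤ cap C (F.filter fun S => p ∉ S ∧ q ∉ S)) (Q : Finset (Finset (Fin K))) :
    ∑ T ∈ Q, labelRate p q v x y z T ≤ cap C (downIn F Q) := by
  have hle := cap_filter_le_cap_downIn hC hF (Q := Q)
  have hsub_p : ∀ S, q ∉ S → S ⊆ insert p (privRecv K) := fun S => subset_insert_privRecv hpq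
  have hsub_q : ∀ S, p ∉ S → S ⊆ insert q (privRecv K) := fun S =>
    subset_insert_privRecv (hpq.trans (Finset.pair_comm p q))
  rw [sum_labelRate]
  by_cases hu : Finset.univ ∈ Q
  · have := hle (fun _ => True) fun S _ => ⟨_, hu, S.subset_univ⟩
    rw [Finset.filter_true] at this
    split_ifs <;> linarith
  by_cases hp : insert p (privRecv K) ∈ Q <;> by_cases hq : insert q (privRecv K) ∈ Q
  · have := hle (fun S => ¬ (p ∈ S ∧ q ∈ S)) fun S hS => (not_and_or.1 hS).elim
      (fun h => ⟨_, hq, hsub_q S h⟩) fun h => ⟨_, hp, hsub_p S h⟩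
    simp only [hu, hp, hq, if_true, if_false]
    split_ifs <;> linarith
  · have := hle (fun S => q ∉ S) fun S hS => ⟨_, hp, hsub_p S hS⟩
    simp only [hu, hp, hq, if_true, if_false]
    split_ifs <;> linarith
  · have := hle (fun S => p ∉ S) fun S hS => ⟨_, hq, hsub_q S hS⟩
    simp only [hu, hp, hq, if_true, if_false]
    split_ifs <;> linarith
  · simp only [hu, hp, hq, if_false, zero_add]
    split_ifs with hpriv
    · exact hz'.trans (hle _ fun S hS => ⟨_, hpriv, (subset_privRecv_iff hpq).2 hS⟩)
    · exact Finset.sum_nonneg fun S hS => hC S (hF (Finset.inter_subset_right hS))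

theorem sum_labelRate_le_of_mem_commonRecv {p q : Fin K} (hne : p ≠ q)
    (hpq : commonRecv K = {p, q}) {C : Finset (Fin K) → ℝ} (hC : ∀ S ∈ P K, 0 ≤ C S) {v x : ℝ}
    (hx : 0 ≤ x) (hvx : v + x ≤ cap C (W p (P K)))
    (hx' : x ≤ cap C ((W p (P K)).filter fun S => q ∉ S)) (y z : ℝ)
    {Q : Finset (Finset (Fin K))} (hQ : Q ⊆ W p (P K)) :
    ∑ T ∈ Q, labelRate p q v x y z T ≤ cap C (downIn (W p (P K)) Q) := by
  have hmem : ∀ T ∈ Q, p ∈ T := fun T hT => (Finset.mem_filter.1 (hQ hT)).2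
  have hq : insert q (privRecv K) ∉ Q := fun h => by
    simpa [hne, mem_privRecv, hpq] using hmem _ h
  have hpriv : privRecv K ∉ Q := fun h => by simpa [mem_privRecv, hpq] using hmem _ h
  have hnonneg : ∀ (a : Finset (Fin K) → Prop) [DecidablePred a],
      0 ≤ cap C ((W p (P K)).filter a) := fun a _ =>
    Finset.sum_nonneg fun S hS => hC S (W_subset (Finset.mem_of_mem_filter S hS))
  have hload := sum_labelRate_le_cap_downIn hpq hC (W_subset (i := p)) (v := v) hx le_rfl le_rfl
    (by simpa using hvx) ?_ (by simpa using hx') ?_ ?_ Q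
  · simpa [sum_labelRate, hq, hpriv] using hload
  · have hfilter : (W p (P K)).filter (fun S => ¬ (p ∈ S ∧ q ∈ S)) =
        (W p (P K)).filter fun S => q ∉ S :=
      Finset.filter_congr fun S hS => by simp [(Finset.mem_filter.1 hS).2]
    rw [hfilter, add_zero, add_zero]
    exact hx'
  · rw [add_zero]
    exact hnonneg _
  · exact hnonneg _

theorem labelRate_swap (p q : Fin K) (v x y z : ℝ) (T : Finset (Fin K)) :
    labelRate q p v y x z T = labelRate p q v x y z T := by
  unfold labelRate
  ring

theorem cap_filter_cells (C : Finset (Fin K) → ℝ) (F : Finset (Finset (Fin K))) (p q : Fin K) :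
    let A := cap C (F.filter fun S => p ∈ S ∧ q ∉ S)
    let B := cap C (F.filter fun S => q ∈ S ∧ p ∉ S)
    let D := cap C (F.filter fun S => p ∉ S ∧ q ∉ S)
    cap C F = cap C (F.filter fun S => p ∈ S ∧ q ∈ S) + A + (B + D) ∧
      cap C (W p F) = cap C (F.filter fun S => p ∈ S ∧ q ∈ S) + A ∧
      cap C (W q F) = cap C (F.filter fun S => p ∈ S ∧ q ∈ S) + B ∧
      cap C (F.filter fun S => ¬ (p ∈ S ∧ q ∈ S)) = A + (B + D) ∧
      cap C (F.filter fun S => q ∉ S) = A + D ∧ cap C (F.filter fun S => p ∉ S) = B + D := by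
  simp only [cap, W, Finset.sum_filter, ← Finset.sum_add_distrib]
  refine ⟨?_, ?_, ?_, ?_, ?_, ?_⟩ <;> refine Finset.sum_congr rfl fun S _ => ?_ <;>
    by_cases hp : p ∈ S <;> by_cases hq : q ∈ S <;> simp [hp, hq]

theorem cap_filter_W_mem_Icc {C : Finset (Fin K) → ℝ} (hC : ∀ S ∈ P K, 0 ≤ C S) (j : Fin K)
    (a : Finset (Fin K) → Prop) [DecidablePred a] :
    cap C ((W j (P K)).filter a) ∈ Set.Icc 0 (cap C ((P K).filter a)) :=
  ⟨Finset.sum_nonneg fun S hS => hC S (W_subset (Finset.mem_of_mem_filter S hS)),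
    Finset.sum_le_sum_of_subset_of_nonneg (Finset.filter_subset_filter _ W_subset)
      fun S hS _ => hC S (Finset.mem_of_mem_filter S hS)⟩

theorem exists_private_split_of_mem_region (hK : 3 ≤ K) {p q : Fin K} (hne : p ≠ q)
    (hpq : commonRecv K = {p, q}) {C : Finset (Fin K) → ℝ} (hC : ∀ S ∈ P K, 0 ≤ C S)
    {R : nested K → ℝ} (hR : R ∈ region C) :
    ∃ u x y z : ℝ, (0 ≤ u ∧ 0 ≤ x ∧ 0 ≤ y ∧ 0 ≤ z) ∧ u + x + y + z = rateP R ∧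
      (rateC R + u + x ≤ cap C (W p (P K)) ∧ x ≤ cap C ((W p (P K)).filter fun S => q ∉ S)) ∧
      (rateC R + u + y ≤ cap C (W q (P K)) ∧ y ≤ cap C ((W q (P K)).filter fun S => p ∉ S)) ∧
      ∀ j ∈ privRecv K,
        x + y + z ≤ cap C ((W j (P K)).filter fun S => ¬ (p ∈ S ∧ q ∈ S)) ∧
        x + z ≤ cap C ((W j (P K)).filter fun S => q ∉ S) ∧
        y + z ≤ cap C ((W j (P K)).filter fun S => p ∉ S) ∧
        z ≤ cap C ((W j (P K)).filter fun S => p ∉ S ∧ q ∉ S) := by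
  obtain ⟨-, hrp, hcommon, hpriv, hsum₂⟩ := hR
  obtain ⟨-, hp, hq, -⟩ := cap_filter_cells C (P K) p q
  have hcell := cap_filter_W_mem_Icc hC
  simp only [hpq, Finset.sum_pair hne, downIn_privRecv hpq, hp, hq] at hsum₂
  have hA := hcommon p (by simp [hpq])
  have hB := hcommon q (by simp [hpq])
  rw [hp] at hA
  rw [hq] at hB
  have hsum₁ : ∀ j ∈ privRecv K, rateC R + rateP R ≤
      cap C ((P K).filter fun S => p ∈ S ∧ q ∈ S) +
        cap C ((W j (P K)).filter fun S => p ∈ S ∧ q ∉ S) +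
        (cap C ((W j (P K)).filter fun S => q ∈ S ∧ p ∉ S) +
          cap C ((W j (P K)).filter fun S => p ∉ S ∧ q ∉ S)) := fun j hj => by
    linarith [hpriv j hj, (cap_filter_cells C (W j (P K)) p q).1,
      (hcell j fun S => p ∈ S ∧ q ∈ S).2]
  obtain ⟨u, x, y, z, hnonneg, hsum, hload_p, hload_q, hload⟩ :=
    exists_private_split (privRecv_nonempty hK) (fun j _ => hcell j fun S => p ∈ S ∧ q ∉ S)
      (fun j _ => hcell j fun S => q ∈ S ∧ p ∉ S)
      (fun j _ => (hcell j fun S => p ∉ S ∧ q ∉ S).1) hrp hA hB hsum₁ hsum₂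
  refine ⟨u, x, y, z, hnonneg, hsum, ?_, ?_, fun j hj => ?_⟩
  · rwa [hp, W, Finset.filter_filter]
  · rwa [hq, W, Finset.filter_filter]
  · obtain ⟨-, -, -, hj₁, hj₂, hj₃⟩ := cap_filter_cells C (W j (P K)) p q
    rw [hj₁, hj₂, hj₃]
    exact hload j hj

/-- The common message is sent to everybody as one part, and the private message is split into four
parts, of which only the one of rate `u` is also decoded by both common receivers. -/
def nestedRate (p q : Fin K) (rc u x y z : ℝ) (S : nested K) (T : Finset (Fin K)) : ℝ :=
  if S = commonIdx K then if T = Finset.univ then rc else 0 else labelRate p q u x y z T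

theorem nestedRate_commonIdx (p q : Fin K) (rc u x y z : ℝ) (T : Finset (Fin K)) :
    nestedRate p q rc u x y z (commonIdx K) T = if T = Finset.univ then rc else 0 :=
  if_pos rfl

theorem nestedRate_privIdx (hK : 2 ≤ K) (p q : Fin K) (rc u x y z : ℝ) (T : Finset (Fin K)) :
    nestedRate p q rc u x y z (privIdx K) T = labelRate p q u x y z T :=
  if_neg (commonIdx_ne_privIdx hK).symm

theorem sum_nestedRate (hK : 2 ≤ K) (p q : Fin K) (rc u x y z : ℝ) (T : Finset (Fin K)) :
    ∑ S, nestedRate p q rc u x y z S T = labelRate p q (rc + u) x y z T := by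
  rw [sum_nested hK, nestedRate_commonIdx, nestedRate_privIdx hK, labelRate, labelRate]
  split_ifs <;> ring

theorem region_subset_superpositionRegion (hK : 3 ≤ K) {C : Finset (Fin K) → ℝ}
    (hC : ∀ S ∈ P K, 0 ≤ C S) : region C ⊆ superpositionRegion C (nested K) := by
  intro R hR
  have hK2 : 2 ≤ K := by omega
  obtain ⟨p, q, hne, hpq⟩ := exists_commonRecv_eq hK2
  obtain ⟨u, x, y, z, ⟨hu, hx, hy, hz⟩, hsum, ⟨hp, hp'⟩, ⟨hq, hq'⟩, hpriv⟩ :=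
    exists_private_split_of_mem_region hK hne hpq hC hR
  refine ⟨nestedRate p q (rateC R) u x y z, fun S T => ?_, fun S T hST => ?_, fun S => ?_,
    fun k Q hQ => ?_⟩
  · unfold nestedRate
    split_ifs
    exacts [hR.1, le_rfl, labelRate_nonneg hu hx hy hz T]
  · rcases eq_commonIdx_or_eq_privIdx S with rfl | rfl
    · rw [nestedRate_commonIdx, ne_eq, ite_eq_right_iff, Classical.not_imp] at hST
      exact hST.1.ge
    · rw [nestedRate_privIdx hK2] at hST
      exact privRecv_subset_of_labelRate_ne_zero hST
  · rcases eq_commonIdx_or_eq_privIdx S with rfl | rfl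
    · simp only [nestedRate_commonIdx, Finset.sum_ite_eq', Finset.mem_univ, if_true]
      rfl
    · simp only [nestedRate_privIdx hK2, sum_labelRate, Finset.mem_univ, if_true]
      exact hsum
  · simp only [sum_nestedRate hK2]
    by_cases hk : k ∈ privRecv K
    · obtain ⟨hxyz, hxz, hyz, hz'⟩ := hpriv k hk
      refine sum_labelRate_le_cap_downIn hpq hC W_subset hx hy hz ?_ hxyz hxz hyz hz' Q
      linarith [hR.2.2.2.1 k hk]
    · rw [mem_privRecv, not_not, hpq, Finset.mem_insert, Finset.mem_singleton] at hk
      rcases hk with rfl | rfl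
      · exact sum_labelRate_le_of_mem_commonRecv hne hpq hC hx hp hp' y z hQ
      · simp only [← labelRate_swap p k]
        exact sum_labelRate_le_of_mem_commonRecv hne.symm (hpq.trans (Finset.pair_comm p k)) hC
          hy hq hq' x z hQ

theorem capacityRegion_eq_region (hK : 3 ≤ K) {C : Finset (Fin K) → ℝ}
    (hC : ∀ S ∈ P K, 0 ≤ C S) {w : ℕ → Finset (Fin K) → ℕ} (hw : LinkSizes C w) :
    capacityRegion (fun n => combChannel (w n)) (nested K) = region C :=
  (capacityRegion_subset_region (by omega) hw).antisymm
    ((region_subset_superpositionRegion hK hC).trans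
      (superpositionRegion_subset_capacityRegion hw))

end CombNet

theorem mainTheorem7 (K : ℕ) (hK : 3 ≤ K) (C : Finset (Fin K) → ℝ)
    (hC : ∀ S ∈ CombNet.P K, 0 ≤ C S) :
    CombNet.capacityRegion (CombNet.combLinks C) (CombNet.nested K) = CombNet.region C ∧
    ∀ v : Finset (Fin K) → ℕ, (∀ S ∈ CombNet.P K, (v S : ℝ) = (2 : ℝ) ^ C S) →
      CombNet.capacityRegion (CombNet.combDMBC v) (CombNet.nested K) = CombNet.region C := by
  refine ⟨CombNet.capacityRegion_eq_region hK hC (CombNet.LinkSizes.of_floor hC), fun v hv => ?_⟩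
  rw [CombNet.capacityRegion_combDMBC]
  exact CombNet.capacityRegion_eq_region hK hC (CombNet.LinkSizes.of_pow hv)
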